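/- Let $d,n\ge 1$. Let $P$ be a Borel probability measure on $\mathbb{R}^d$ supported in $[-1,1]^d$, let $\sigma(z)=\max(z,0)$, and let $\rho_0$ be a Borel probability measure on $\mathbb{R}^d\times\mathbb{R}$ with $\|\mathbf{w}\|_1+|b|\le 1$ for $\rho_0$-almost every $(\mathbf{w},b)$. For $a\in L^2(\rho_0)$ put $$V_a(\mathbf{x})=\int a(\mathbf{w},b)\,\sigma(\mathbf{w}\cdot\mathbf{x}+b)\,d\rho_0(\mathbf{w},b),$$ and for a function $V$ on $\mathbb{R}^d$ let $\|V\|_{\mathcal H}=\inf\{\|a\|_{L^2(\rho_0)} : a\in L^2(\rho_0),\ V_a=V\ P\text{-a.e.}\}\in[0,\infty]$. The distribution generated by a potential $V$ is $\frac{e^{-V}P}{\mathbb{E}_P[e^{-V}]}$. Let $Q_*$ be the distribution generated by a potential $V_*$ with $\|V_*\|_{\mathcal H}<\infty$. Let $Q_*^{(n)}=\frac1n\sum_{i=1}^n\delta_{\mathbf{x}_i}$ be the empirical distribution of $n$ independent samples $\mathbf{x}_i$ from $Q_*$, and let $$L^{(n)}(a)=\mathbb{E}_{Q_*^{(n)}}[V_a]+\log\mathbb{E}_P[e^{-V_a}],\qquad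 a\in L^2(\rho_0).$$ Fix $a_0\in L^2(\rho_0)$, put $V_0=V_{a_0}$, let $(a_t^{(n)})_{t\ge0}$ be the gradient flow $\frac{d}{dt}a_t^{(n)}=-\nabla L^{(n)}(a_t^{(n)})$ in $L^2(\rho_0)$ with $a_0^{(n)}=a_0$, and let $Q_t^{(n)}$ be the distribution generated by $V_{a_t^{(n)}}$. Then for every $\delta\in(0,1)$, with probability at least $1-\delta$ over the sample, for all $t>0$, $$KL\big(Q_*\,\|\,Q_t^{(n)}\big)\le\frac{\|V_*-V_0\|_{\mathcal H}^2}{2t}+2\Big(4\frac{\sqrt{2\log 2d}}{\sqrt n}+\frac{\sqrt{2\log(2/\delta)}}{\sqrt n}\Big)t.$$ -/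

import Mathlib

open MeasureTheory

open scoped ENNReal

noncomputable section

namespace BiasPotential

/-- The rectified linear unit. -/
def relu (z : ℝ) : ℝ := max z 0

/-- The random feature potential `V_a(x) = 𝔼_{ρ₀(w,b)} [a(w,b) σ(w ⬝ x + b)]` with ReLU activation,
a function on `ℝ^d`, for a parameter function `a ∈ L²(ρ₀)`. -/
def potential {d : ℕ} (ρ₀ : Measure ((Fin d → ℝ) × ℝ)) (a : Lp ℝ 2 ρ₀) (x : Fin d → ℝ) : ℝ :=
  ∫ θ, a θ * relu (θ.1 ⬝ᵥ x + θ.2) ∂ρ₀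

/-- The RKHS norm of a potential `V`: the least `‖a‖_{L²(ρ₀)}` over all parameter functions `a`
that represent `V` (`P`-almost everywhere), and `∞` if there is none. -/
def rkhsNorm {d : ℕ} (ρ₀ : Measure ((Fin d → ℝ) × ℝ)) (P : Measure (Fin d → ℝ))
    (V : (Fin d → ℝ) → ℝ) : ℝ≥0∞ :=
  ⨅ (a : Lp ℝ 2 ρ₀) (_ : V =ᵐ[P] potential ρ₀ a), ‖a‖ₑ

/-- The distribution `Z⁻¹ e^{-V} P`, `Z = 𝔼_P[e^{-V}]`, generated by the potential `V` and the base
distribution `P`. -/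
def generated {d : ℕ} (P : Measure (Fin d → ℝ)) (V : (Fin d → ℝ) → ℝ) : Measure (Fin d → ℝ) :=
  P.tilted (fun x => -V x)

/-- The objective `L⁻(V) = 𝔼_Q[V] + log 𝔼_P[e^{-V}]` for the (population or empirical) target
distribution `Q`. -/
def objective {d : ℕ} (P Q : Measure (Fin d → ℝ)) (V : (Fin d → ℝ) → ℝ) : ℝ :=
  ∫ x, V x ∂Q + Real.log (∫ x, Real.exp (-V x) ∂P)

/-- The empirical distribution `(1/n) ∑ᵢ δ_{xᵢ}` of a sample. -/
def empirical {d n : ℕ} (x : Fin n → Fin d → ℝ) : Measure (Fin d → ℝ) :=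
  (n : ℝ≥0∞)⁻¹ • ∑ i, Measure.dirac (x i)

/-- `a : [0, ∞) → H` is a trajectory of the gradient flow `a'(t) = -∇F(a(t))`, `a(0) = a₀`, in a
Hilbert space. Values of `a` at negative times are irrelevant. -/
def IsGradientFlow {H : Type*} [NormedAddCommGroup H] [InnerProductSpace ℝ H] [CompleteSpace H]
    (F : H → ℝ) (a₀ : H) (a : ℝ → H) : Prop :=
  a 0 = a₀ ∧ ∀ t : ℝ, 0 ≤ t →
    ∃ g : H, HasGradientAt F g (a t) ∧ HasDerivWithinAt a (-g) (Set.Ici 0) t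

end BiasPotential

end

namespace BiasPotential

/-! Let `y` represent `V_*` and put `h = a_t - y`. Then `KL(Q_* ‖ Q_t)` is the population excess
objective of `a_t` over `y`, hence the empirical excess plus a sampling error linear in `h`. Since
the empirical objective has a subgradient everywhere, the flow satisfies `t * excess + ‖h‖² / 2 ≤
‖a₀ - y‖² / 2` (`IsGradientFlow.mul_sub_add_le`). The sampling error is `-∫ h e dρ₀`, where `e θ` is
the empirical minus the true mean of the single feature `θ`. By Young's inequality and `|e| ≤ 1` it
is at most `‖h‖² / (2t) + (t/2) ∫ |e| dρ₀` (`neg_integral_mul_le`), and the `‖h‖²` terms cancel.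
What remains random, `∫ |e| dρ₀`, involves neither `y` nor `t` nor the trajectory, so one event
serves all of them. Its tail follows from Hoeffding's lemma for each feature, averaged over `ρ₀`
(`measure_le_integral_abs_mean_sub`). No uniform bound over an RKHS ball is used, so the `log 2d`
term is pure slack. -/

/-! ### Gradient flow of a convex function -/

/-- A gradient is a subgradient as soon as some linear subgradient exists at that point. -/
theorem add_inner_le_of_hasGradientAt {H : Type*} [NormedAddCommGroup H] [InnerProductSpace ℝ H]
    [CompleteSpace H] {F : H → ℝ} {b g : H} (hg : HasGradientAt F g b) (l : H →ₗ[ℝ] ℝ)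
    (hl : ∀ y, F b + l (y - b) ≤ F y) (y : H) : F b + inner ℝ g (y - b) ≤ F y := by
  have key : inner ℝ g (y - b) = l (y - b) := by
    have hline : HasDerivAt (fun s : ℝ => b + s • (y - b)) (y - b) 0 := by
      simpa using ((hasDerivAt_id (0 : ℝ)).smul_const (y - b)).const_add b
    have hF : HasFDerivAt F (InnerProductSpace.toDual ℝ H g) (b + (0 : ℝ) • (y - b)) := by
      simpa using hg.hasFDerivAt
    have h1 : HasDerivAt (fun s : ℝ => F (b + s • (y - b))) (inner ℝ g (y - b)) 0 := by
      have h := hF.comp_hasDerivAt (0 : ℝ) hline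
      rw [InnerProductSpace.toDual_apply_apply] at h
      exact h
    have h2 : HasDerivAt (fun s : ℝ => F (b + s • (y - b)) - s * l (y - b))
        (inner ℝ g (y - b) - l (y - b)) 0 := by
      have h := h1.sub ((hasDerivAt_id (0 : ℝ)).mul_const (l (y - b)))
      rw [one_mul] at h
      exact h
    -- The subgradient inequality along the segment puts a minimum at `s = 0`, which forces both
    -- slopes to agree.
    have hmin : IsLocalMin (fun s : ℝ => F (b + s • (y - b)) - s * l (y - b)) 0 :=
      Filter.Eventually.of_forall fun s => by
        have := hl (b + s • (y - b))
        simp only [add_sub_cancel_left, map_smul, smul_eq_mul] at this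
        simp only [zero_smul, add_zero, zero_mul, sub_zero]
        linarith
    have := hmin.hasDerivAt_eq_zero h2
    linarith
  rw [key]
  exact hl y

/-- The energy estimate for the gradient flow of a convex function, compared with any point. -/
theorem IsGradientFlow.mul_sub_add_le {H : Type*} [NormedAddCommGroup H] [InnerProductSpace ℝ H]
    [CompleteSpace H] {F : H → ℝ} {a₀ : H} {a : ℝ → H} (h : IsGradientFlow F a₀ a) (y : H)
    (hF : ∀ b g, HasGradientAt F g b → F b + inner ℝ g (y - b) ≤ F y) {t : ℝ} (ht : 0 ≤ t) :
    t * (F (a t) - F y) + ‖a t - y‖ ^ 2 / 2 ≤ ‖a₀ - y‖ ^ 2 / 2 := by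
  obtain ⟨h0, hflow⟩ := h
  -- Lyapunov function: its derivative is `F (a s) - F y - s‖g‖² - ⟪g, a s - y⟫`, nonpositive by the
  -- subgradient inequality.
  set D : ℝ → ℝ := fun s => s * (F (a s) - F y) + ‖a s - y‖ ^ 2 / 2 with hD
  have hder : ∀ s : ℝ, 0 ≤ s → ∃ m ≤ 0, HasDerivWithinAt D m (Set.Ici 0) s := by
    intro s hs
    obtain ⟨g, hg, ha⟩ := hflow s hs
    have h1 : HasDerivWithinAt (fun r => F (a r)) (inner ℝ g (-g)) (Set.Ici 0) s := by
      have h := hg.hasFDerivAt.comp_hasDerivWithinAt s ha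
      rw [InnerProductSpace.toDual_apply_apply] at h
      exact h
    have h2 := ((hasDerivWithinAt_id s (Set.Ici 0)).mul (h1.sub_const (F y))).add
      ((ha.sub_const y).norm_sq.div_const 2)
    refine ⟨_, ?_, h2⟩
    have h3 := hF _ _ hg
    have h4 : inner ℝ g (y - a s) = inner ℝ (a s - y) (-g) := by
      rw [inner_neg_right, real_inner_comm, ← inner_neg_left, neg_sub]
    have h5 : inner ℝ g (-g) = -‖g‖ ^ 2 := by
      rw [inner_neg_right, real_inner_self_eq_norm_sq]
    rw [h4] at h3
    rw [h5]
    simp only [id]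
    nlinarith [mul_nonneg hs (sq_nonneg ‖g‖)]
  have hanti : AntitoneOn D (Set.Ici 0) := by
    refine antitoneOn_of_deriv_nonpos (convex_Ici 0) ?_ ?_ ?_
    · intro s hs
      obtain ⟨m, -, hm⟩ := hder s hs
      exact hm.continuousWithinAt
    · intro s hs
      rw [interior_Ici] at hs ⊢
      obtain ⟨m, -, hm⟩ := hder s hs.le
      exact (hm.hasDerivAt (Ici_mem_nhds hs)).differentiableAt.differentiableWithinAt
    · intro s hs
      rw [interior_Ici] at hs
      obtain ⟨m, hm0, hm⟩ := hder s hs.le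
      rw [(hm.hasDerivAt (Ici_mem_nhds hs)).deriv]
      exact hm0
  have := hanti (Set.mem_Ici.2 le_rfl) (Set.mem_Ici.2 ht) ht
  simpa [hD, h0] using this

/-! ### Relative entropy of Gibbs measures -/

/-- A bounded exponent has an integrable exponential. -/
theorem integrable_exp_of_bound {X : Type*} [MeasurableSpace X] {P : Measure X}
    [IsFiniteMeasure P] {V : X → ℝ} (hV : AEMeasurable V P) {C : ℝ} (hC : ∀ᵐ x ∂P, |V x| ≤ C) :
    Integrable (fun x => Real.exp (V x)) P := by
  refine Integrable.of_bound hV.exp.aestronglyMeasurable (Real.exp C) ?_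
  filter_upwards [hC] with x hx
  rw [Real.norm_eq_abs, Real.abs_exp]
  exact Real.exp_le_exp.2 (abs_le.1 hx).2

/-- The Kullback-Leibler divergence between two Gibbs measures with bounded potentials. -/
theorem klDiv_tilted_neg {X : Type*} [MeasurableSpace X] {P : Measure X}
    [IsProbabilityMeasure P] {V W : X → ℝ} (hV : AEMeasurable V P) (hW : AEMeasurable W P)
    {C D : ℝ} (hC : ∀ᵐ x ∂P, |V x| ≤ C) (hD : ∀ᵐ x ∂P, |W x| ≤ D) :
    0 ≤ ∫ x, W x ∂(P.tilted fun x => -V x) - ∫ x, V x ∂(P.tilted fun x => -V x)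
        + Real.log (∫ x, Real.exp (-W x) ∂P) - Real.log (∫ x, Real.exp (-V x) ∂P) ∧
    InformationTheory.klDiv (P.tilted fun x => -V x) (P.tilted fun x => -W x) =
      ENNReal.ofReal (∫ x, W x ∂(P.tilted fun x => -V x) - ∫ x, V x ∂(P.tilted fun x => -V x)
        + Real.log (∫ x, Real.exp (-W x) ∂P) - Real.log (∫ x, Real.exp (-V x) ∂P)) := by
  have eV : Integrable (fun x => Real.exp (-V x)) P :=
    integrable_exp_of_bound hV.neg (by simpa using hC)
  have eW : Integrable (fun x => Real.exp (-W x)) P :=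
    integrable_exp_of_bound hW.neg (by simpa using hD)
  set Q := P.tilted fun x => -V x with hQ
  have : IsProbabilityMeasure Q := isProbabilityMeasure_tilted eV
  have : IsProbabilityMeasure (P.tilted fun x => -W x) := isProbabilityMeasure_tilted eW
  have hQP : Q ≪ P := tilted_absolutelyContinuous _ _
  have hPW : P ≪ P.tilted fun x => -W x := absolutelyContinuous_tilted eW
  have iV : Integrable V Q :=
    Integrable.of_bound (hV.mono_ac hQP).aestronglyMeasurable C (hQP.ae_le hC)
  have iW : Integrable W Q :=
    Integrable.of_bound (hW.mono_ac hQP).aestronglyMeasurable D (hQP.ae_le hD)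
  have hllr : llr Q P =ᵐ[Q] fun x => -V x - Real.log (∫ x, Real.exp (-V x) ∂P) :=
    hQP.ae_le (log_rnDeriv_tilted_left_self eV)
  have illr : Integrable (llr Q P) Q := (iV.neg.sub (integrable_const _)).congr hllr.symm
  have illr' : Integrable (llr Q (P.tilted fun x => -W x)) Q :=
    integrable_llr_tilted_right hQP iW.neg illr eW
  have hac : Q ≪ P.tilted fun x => -W x := hQP.trans hPW
  have hne := InformationTheory.klDiv_ne_top hac illr'
  have hkl := InformationTheory.toReal_klDiv_of_measure_eq hac (by simp)
  have h1 : ∫ x, llr Q (P.tilted fun x => -W x) x ∂Q = ∫ x, llr Q P x ∂Q - ∫ x, -W x ∂Q +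
      Real.log (∫ x, Real.exp (-W x) ∂P) := integral_llr_tilted_right hQP iW.neg eW illr
  have h2 : ∫ x, llr Q P x ∂Q = ∫ x, -V x ∂Q - Real.log (∫ x, Real.exp (-V x) ∂P) := by
    rw [integral_congr_ae hllr, integral_sub (by exact iV.neg) (integrable_const _)]
    simp
  rw [h1, h2, integral_neg, integral_neg] at hkl
  have heq : (InformationTheory.klDiv Q (P.tilted fun x => -W x)).toReal =
      ∫ x, W x ∂Q - ∫ x, V x ∂Q + Real.log (∫ x, Real.exp (-W x) ∂P)
        - Real.log (∫ x, Real.exp (-V x) ∂P) := by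
    rw [hkl]; ring
  rw [← heq]
  exact ⟨ENNReal.toReal_nonneg, (ENNReal.ofReal_toReal hne).symm⟩

/-! ### Concentration of averaged empirical deviations -/

/-- The moment generating function bound for the deviation of an empirical mean. -/
theorem lintegral_exp_mean_sub_le {X : Type*} [MeasurableSpace X] (Q : Measure X)
    [IsProbabilityMeasure Q] {g : X → ℝ} (hg : Measurable g)
    (hg01 : ∀ᵐ x ∂Q, g x ∈ Set.Icc (0 : ℝ) 1) {n : ℕ} (hn : 1 ≤ n) (l : ℝ) :
    ∫⁻ x : Fin n → X, ENNReal.ofReal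
        (Real.exp (l * ((∑ i, g (x i)) / n - ∫ y, g y ∂Q))) ∂(Measure.pi fun _ => Q) ≤
      ENNReal.ofReal (Real.exp (l ^ 2 / (8 * n))) := by
  have hn0 : (n : ℝ) ≠ 0 := by positivity
  have hsub := ProbabilityTheory.hasSubgaussianMGF_of_mem_Icc hg.aemeasurable hg01
  have hprod : ∀ x : Fin n → X, Real.exp (l * ((∑ i, g (x i)) / n - ∫ y, g y ∂Q)) =
      ∏ i, Real.exp (l / n * (g (x i) - ∫ y, g y ∂Q)) := by
    intro x
    rw [← Real.exp_sum, ← Finset.mul_sum, Finset.sum_sub_distrib]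
    congr 1
    simp only [Finset.sum_const, Finset.card_univ, Fintype.card_fin, nsmul_eq_mul]
    field_simp
  simp_rw [hprod]
  rw [← ofReal_integral_eq_lintegral_ofReal]
  · refine ENNReal.ofReal_le_ofReal ?_
    rw [integral_fintype_prod_eq_pow (fun y => Real.exp (l / n * (g y - ∫ y, g y ∂Q)))]
    -- Hoeffding's lemma gives variance proxy 1/4, so `n` factors contribute `n * (1/4) * (l/n)² / 2
    -- = l² / (8n)`.
    have h1 := hsub.mgf_le (l / n)
    calc _ ≤ (Real.exp (((‖(1 : ℝ) - 0‖₊ / 2) ^ 2 : NNReal) * (l / n) ^ 2 / 2)) ^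
          (Fintype.card (Fin n)) := by
            refine pow_le_pow_left₀ (integral_nonneg fun y => (Real.exp_pos _).le) h1 _
      _ = Real.exp (l ^ 2 / (8 * n)) := by
            rw [← Real.exp_nat_mul]
            congr 1
            simp
            field_simp
            ring
  · exact Integrable.fintype_prod fun _ => hsub.integrable_exp_mul (l / n)
  · exact Filter.Eventually.of_forall fun x => Finset.prod_nonneg fun i _ => (Real.exp_pos _).le

theorem measurable_mean_sub {X Θ : Type*} [MeasurableSpace X] [MeasurableSpace Θ] (Q : Measure X)
    [IsProbabilityMeasure Q] {f : Θ → X → ℝ} (hf : Measurable (Function.uncurry f)) (n : ℕ) :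
    Measurable fun p : (Fin n → X) × Θ =>
      (∑ i, f p.2 (p.1 i)) / n - ∫ y, f p.2 y ∂Q := by
  refine Measurable.sub (Measurable.div_const (Finset.measurable_fun_sum _ fun i _ => ?_) _) ?_
  · exact hf.comp (measurable_snd.prodMk ((measurable_pi_apply i).comp measurable_fst))
  · exact (hf.stronglyMeasurable.integral_prod_right').measurable.comp measurable_snd

/-- The deviation of the mean of values in the unit interval from their expectation is at
most one. -/
theorem abs_mean_sub_le {X : Type*} [MeasurableSpace X] {Q : Measure X}
    [IsProbabilityMeasure Q] {g : X → ℝ} (hg : Measurable g) {K : Set X}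
    (hK : ∀ᵐ x ∂Q, x ∈ K) (hg01 : ∀ x ∈ K, g x ∈ Set.Icc (0 : ℝ) 1) {n : ℕ} (hn : 1 ≤ n)
    {x : Fin n → X} (hx : ∀ i, x i ∈ K) :
    |(∑ i, g (x i)) / n - ∫ y, g y ∂Q| ≤ 1 := by
  have hn0 : (0 : ℝ) < n := by positivity
  have h1 : 0 ≤ ∫ y, g y ∂Q :=
    integral_nonneg_of_ae (hK.mono fun y hy => (hg01 y hy).1)
  have h2 : ∫ y, g y ∂Q ≤ 1 := by
    have hgK : ∀ᵐ y ∂Q, g y ∈ Set.Icc (0 : ℝ) 1 := hK.mono hg01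
    calc ∫ y, g y ∂Q ≤ ∫ _, (1 : ℝ) ∂Q :=
          integral_mono_ae (Integrable.of_mem_Icc 0 1 hg.aemeasurable hgK) (integrable_const _)
            (hgK.mono fun y hy => hy.2)
      _ = 1 := by simp
  have h3 : 0 ≤ (∑ i, g (x i)) / n :=
    div_nonneg (Finset.sum_nonneg fun i _ => (hg01 _ (hx i)).1) hn0.le
  have h4 : (∑ i, g (x i)) / n ≤ 1 := by
    rw [div_le_one hn0]
    calc ∑ i, g (x i) ≤ ∑ _i : Fin n, (1 : ℝ) :=
          Finset.sum_le_sum fun i _ => (hg01 _ (hx i)).2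
      _ = n := by simp
  rw [abs_le]
  constructor <;> linarith

theorem ae_pi_forall_mem {X : Type*} [MeasurableSpace X] {Q : Measure X}
    [IsProbabilityMeasure Q] {K : Set X} (hK : ∀ᵐ x ∂Q, x ∈ K) (n : ℕ) :
    ∀ᵐ x ∂(Measure.pi fun _ : Fin n => Q), ∀ i, x i ∈ K :=
  ae_all_iff.2 fun i => (Measure.tendsto_eval_ae_ae (i := i)).eventually hK

/-- Concentration of the averaged absolute deviation of a family of empirical means. -/
theorem measure_le_integral_abs_mean_sub {X Θ : Type*} [MeasurableSpace X] [MeasurableSpace Θ]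
    (Q : Measure X) [IsProbabilityMeasure Q] (ρ : Measure Θ) [IsProbabilityMeasure ρ]
    {f : Θ → X → ℝ} (hf : Measurable (Function.uncurry f)) {K : Set X}
    (hK : ∀ᵐ x ∂Q, x ∈ K) (hf01 : ∀ᵐ θ ∂ρ, ∀ x ∈ K, f θ x ∈ Set.Icc (0 : ℝ) 1)
    {n : ℕ} (hn : 1 ≤ n) {s : ℝ} (hs : 0 ≤ s) :
    (Measure.pi fun _ : Fin n => Q)
        {x | s ≤ ∫ θ, |(∑ i, f θ (x i)) / n - ∫ y, f θ y ∂Q| ∂ρ} ≤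
      ENNReal.ofReal (2 * Real.exp (-2 * n * s ^ 2)) := by
  have hn0 : (0 : ℝ) < n := by positivity
  set μ := Measure.pi fun _ : Fin n => Q with hμ
  set e : (Fin n → X) → Θ → ℝ := fun x θ => (∑ i, f θ (x i)) / n - ∫ y, f θ y ∂Q with he
  have hme : Measurable (Function.uncurry e) := measurable_mean_sub Q hf n
  -- The minimizer of the Chernoff exponent `l² / (8n) - l s`, with value `-2ns²`.
  set l : ℝ := 4 * n * s with hl
  have hl0 : 0 ≤ l := by positivity
  have hT : Measurable fun x => ∫ θ, |e x θ| ∂ρ :=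
    (hme.abs.stronglyMeasurable.integral_prod_right').measurable
  -- Jensen moves the exponential inside the `ρ₀`-average; `exp |u| ≤ exp u + exp (-u)` then removes
  -- the absolute value and is the source of the factor 2.
  have hjensen : ∀ᵐ x ∂μ, ENNReal.ofReal (Real.exp (l * ∫ θ, |e x θ| ∂ρ)) ≤
      ∫⁻ θ, (ENNReal.ofReal (Real.exp (l * e x θ)) +
        ENNReal.ofReal (Real.exp (-l * e x θ))) ∂ρ := by
    filter_upwards [ae_pi_forall_mem hK n] with x hx
    have hex : Measurable (e x) := hme.of_uncurry_left
    have hb : ∀ᵐ θ ∂ρ, |e x θ| ≤ 1 := by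
      filter_upwards [hf01] with θ hθ
      exact abs_mean_sub_le hf.of_uncurry_left hK hθ hn hx
    have hi : Integrable (fun θ => l * |e x θ|) ρ :=
      (Integrable.of_bound hex.abs.aestronglyMeasurable 1 (by simpa using hb)).const_mul l
    have hie : Integrable (fun θ => Real.exp (l * |e x θ|)) ρ := by
      refine Integrable.of_bound (hex.abs.const_mul l).exp.aestronglyMeasurable (Real.exp l) ?_
      filter_upwards [hb] with θ hθ
      rw [Real.norm_eq_abs, Real.abs_exp]
      exact Real.exp_le_exp.2 (mul_le_of_le_one_right hl0 hθ)
    have h1 : Real.exp (l * ∫ θ, |e x θ| ∂ρ) ≤ ∫ θ, Real.exp (l * |e x θ|) ∂ρ := by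
      rw [← integral_const_mul]
      exact convexOn_exp.map_integral_le Real.continuous_exp.continuousOn isClosed_univ
        (by simp) hi hie
    calc _ ≤ ENNReal.ofReal (∫ θ, Real.exp (l * |e x θ|) ∂ρ) := ENNReal.ofReal_le_ofReal h1
      _ = ∫⁻ θ, ENNReal.ofReal (Real.exp (l * |e x θ|)) ∂ρ :=
          ofReal_integral_eq_lintegral_ofReal hie
            (Filter.Eventually.of_forall fun θ => (Real.exp_pos _).le)
      _ ≤ _ := by
          refine lintegral_mono fun θ => ?_
          rcases abs_cases (e x θ) with ⟨h, -⟩ | ⟨h, -⟩ <;> rw [h]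
          · exact le_self_add
          · rw [mul_neg, ← neg_mul]
            exact le_add_self
  have hexp : ∫⁻ x, ENNReal.ofReal (Real.exp (l * ∫ θ, |e x θ| ∂ρ)) ∂μ ≤
      ENNReal.ofReal (2 * Real.exp (l ^ 2 / (8 * n))) := by
    have hpair : ∀ c : ℝ, Measurable fun p : (Fin n → X) × Θ =>
        ENNReal.ofReal (Real.exp (c * e p.1 p.2)) := fun c => (hme.const_mul c).exp.ennreal_ofReal
    calc _ ≤ ∫⁻ x, ∫⁻ θ, (ENNReal.ofReal (Real.exp (l * e x θ)) +
              ENNReal.ofReal (Real.exp (-l * e x θ))) ∂ρ ∂μ := lintegral_mono_ae hjensen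
      _ = ∫⁻ θ, ∫⁻ x, (ENNReal.ofReal (Real.exp (l * e x θ)) +
              ENNReal.ofReal (Real.exp (-l * e x θ))) ∂μ ∂ρ :=
          lintegral_lintegral_swap ((hpair l).add (hpair (-l))).aemeasurable
      _ ≤ ∫⁻ _, ENNReal.ofReal (2 * Real.exp (l ^ 2 / (8 * n))) ∂ρ := by
          refine lintegral_mono_ae ?_
          filter_upwards [hf01] with θ hθ
          have hθm : Measurable fun x => ENNReal.ofReal (Real.exp (l * e x θ)) :=
            ((hme.of_uncurry_right (y := θ)).const_mul l).exp.ennreal_ofReal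
          rw [lintegral_add_left hθm, two_mul,
            ENNReal.ofReal_add (Real.exp_pos _).le (Real.exp_pos _).le]
          have hfθ : Measurable (f θ) := hf.of_uncurry_left
          have hθ' := hK.mono hθ
          refine add_le_add (lintegral_exp_mean_sub_le Q hfθ hθ' hn l) ?_
          rw [← neg_sq l]
          exact lintegral_exp_mean_sub_le Q hfθ hθ' hn (-l)
      _ = _ := by simp
  have hmarkov := mul_meas_ge_le_lintegral₀ (μ := μ)
    (hT.const_mul l).exp.ennreal_ofReal.aemeasurable (ENNReal.ofReal (Real.exp (l * s)))
  have hsubset : {x | s ≤ ∫ θ, |e x θ| ∂ρ} ⊆ {x | ENNReal.ofReal (Real.exp (l * s)) ≤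
      ENNReal.ofReal (Real.exp (l * ∫ θ, |e x θ| ∂ρ))} := fun x hx =>
    ENNReal.ofReal_le_ofReal (Real.exp_le_exp.2 (mul_le_mul_of_nonneg_left hx hl0))
  have hfin : ENNReal.ofReal (Real.exp (l * s)) * μ {x | s ≤ ∫ θ, |e x θ| ∂ρ} ≤
      ENNReal.ofReal (2 * Real.exp (l ^ 2 / (8 * n))) :=
    ((mul_le_mul_right (measure_mono hsubset) _).trans hmarkov).trans hexp
  rw [mul_comm, ← ENNReal.le_div_iff_mul_le (by simp [Real.exp_pos]) (by simp),
    ← ENNReal.ofReal_div_of_pos (Real.exp_pos _), mul_div_assoc, ← Real.exp_sub] at hfin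
  convert hfin using 4
  rw [hl]
  field_simp
  ring

/-! ### Young's inequality for the sampling error -/

/-- Young's inequality for the pairing of a square-integrable and a bounded function. -/
theorem neg_integral_mul_le {Θ : Type*} [MeasurableSpace Θ] {ρ : Measure Θ}
    [IsProbabilityMeasure ρ] (h : Lp ℝ 2 ρ) {e : Θ → ℝ} (hme : AEStronglyMeasurable e ρ)
    (he1 : ∀ᵐ θ ∂ρ, |e θ| ≤ 1) {t : ℝ} (ht : 0 < t) :
    -∫ θ, h θ * e θ ∂ρ ≤ ‖h‖ ^ 2 / (2 * t) + t / 2 * ∫ θ, |e θ| ∂ρ := by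
  have hnorm : ‖h‖ ^ 2 = ∫ θ, h θ ^ 2 ∂ρ := by
    rw [← real_inner_self_eq_norm_sq, L2.inner_def]
    exact integral_congr_ae (Filter.Eventually.of_forall fun θ => by simp [sq])
  have hsq : Integrable (fun θ => h θ ^ 2) ρ := (Lp.memLp h).integrable_sq
  have hei : Integrable e ρ := Integrable.of_bound hme 1 he1
  rw [hnorm, ← integral_neg, ← integral_div, ← integral_const_mul,
    ← integral_add (hsq.div_const _) (hei.abs.const_mul _)]
  refine integral_mono_ae (((Lp.memLp h).integrable one_le_two).mul_bdd hme he1).neg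
    ((hsq.div_const _).add (hei.abs.const_mul _)) ?_
  filter_upwards [he1] with θ hθ
  have h1 : e θ ^ 2 ≤ |e θ| := by
    rw [← sq_abs]
    nlinarith [abs_nonneg (e θ)]
  have h2 : 0 ≤ (h θ + t * e θ) ^ 2 / (2 * t) := by positivity
  have h3 : (h θ + t * e θ) ^ 2 / (2 * t) =
      h θ ^ 2 / (2 * t) + h θ * e θ + t / 2 * e θ ^ 2 := by
    field_simp
    ring
  have h4 : t / 2 * e θ ^ 2 ≤ t / 2 * |e θ| := mul_le_mul_of_nonneg_left h1 (by positivity)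
  linarith

/-! ### Random feature potentials on the cube -/

variable {d : ℕ} {ρ₀ : Measure ((Fin d → ℝ) × ℝ)}

theorem measurable_feature :
    Measurable (Function.uncurry fun (θ : (Fin d → ℝ) × ℝ) (x : Fin d → ℝ) =>
      relu (θ.1 ⬝ᵥ x + θ.2)) := by
  unfold Function.uncurry relu dotProduct
  fun_prop

theorem measurable_mean_feature_sub (Q : Measure (Fin d → ℝ)) [IsProbabilityMeasure Q] {n : ℕ}
    (x : Fin n → Fin d → ℝ) :
    Measurable fun θ : (Fin d → ℝ) × ℝ =>
      (∑ i, relu (θ.1 ⬝ᵥ x i + θ.2)) / n - ∫ z, relu (θ.1 ⬝ᵥ z + θ.2) ∂Q := by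
  refine Measurable.sub (Measurable.div_const (Finset.measurable_fun_sum _ fun i _ => ?_) _) ?_
  · exact measurable_feature.of_uncurry_right
  · exact measurable_feature.stronglyMeasurable.integral_prod_right'.measurable

theorem feature_mem_Icc {θ : (Fin d → ℝ) × ℝ} (hθ : (∑ i, |θ.1 i|) + |θ.2| ≤ 1)
    {x : Fin d → ℝ} (hx : ∀ i, |x i| ≤ 1) : relu (θ.1 ⬝ᵥ x + θ.2) ∈ Set.Icc (0 : ℝ) 1 := by
  refine ⟨le_max_right _ _, max_le ?_ zero_le_one⟩
  have h1 : θ.1 ⬝ᵥ x ≤ ∑ i, |θ.1 i| := Finset.sum_le_sum fun i _ => by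
    calc θ.1 i * x i ≤ |θ.1 i * x i| := le_abs_self _
      _ = |θ.1 i| * |x i| := abs_mul _ _
      _ ≤ |θ.1 i| := mul_le_of_le_one_right (abs_nonneg _) (hx i)
  linarith [le_abs_self θ.2]

theorem abs_mul_feature_le {θ : (Fin d → ℝ) × ℝ} (hθ : (∑ i, |θ.1 i|) + |θ.2| ≤ 1)
    {x : Fin d → ℝ} (hx : ∀ i, |x i| ≤ 1) (c : ℝ) :
    |c * relu (θ.1 ⬝ᵥ x + θ.2)| ≤ |c| := by
  have h := feature_mem_Icc hθ hx
  rw [abs_mul, abs_of_nonneg h.1]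
  exact mul_le_of_le_one_right (abs_nonneg _) h.2

theorem stronglyMeasurable_uncurry_mul_feature (a : Lp ℝ 2 ρ₀) :
    StronglyMeasurable (Function.uncurry fun (x : Fin d → ℝ) (θ : (Fin d → ℝ) × ℝ) =>
      a θ * relu (θ.1 ⬝ᵥ x + θ.2)) :=
  ((Lp.stronglyMeasurable a).comp_measurable measurable_snd).mul
    (measurable_feature.comp measurable_swap).stronglyMeasurable

theorem measurable_potential [SFinite ρ₀] (a : Lp ℝ 2 ρ₀) : Measurable (potential ρ₀ a) :=
  (stronglyMeasurable_uncurry_mul_feature a).integral_prod_right'.measurable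

theorem integrable_mul_feature [IsProbabilityMeasure ρ₀]
    (hρ₀ : ∀ᵐ θ ∂ρ₀, (∑ i, |θ.1 i|) + |θ.2| ≤ 1)
    (a : Lp ℝ 2 ρ₀) {x : Fin d → ℝ} (hx : ∀ i, |x i| ≤ 1) :
    Integrable (fun θ => a θ * relu (θ.1 ⬝ᵥ x + θ.2)) ρ₀ := by
  refine ((Lp.memLp a).integrable one_le_two).mono
    (stronglyMeasurable_uncurry_mul_feature a).of_uncurry_left.aestronglyMeasurable ?_
  filter_upwards [hρ₀] with θ hθ
  exact abs_mul_feature_le hθ hx _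

theorem abs_potential_le [IsProbabilityMeasure ρ₀]
    (hρ₀ : ∀ᵐ θ ∂ρ₀, (∑ i, |θ.1 i|) + |θ.2| ≤ 1)
    (a : Lp ℝ 2 ρ₀) {x : Fin d → ℝ} (hx : ∀ i, |x i| ≤ 1) :
    |potential ρ₀ a x| ≤ ∫ θ, |a θ| ∂ρ₀ := by
  refine (abs_integral_le_integral_abs).trans (integral_mono_ae
    (integrable_mul_feature hρ₀ a hx).abs ((Lp.memLp a).integrable one_le_two).abs ?_)
  filter_upwards [hρ₀] with θ hθ
  exact abs_mul_feature_le hθ hx _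

theorem potential_add [IsProbabilityMeasure ρ₀]
    (hρ₀ : ∀ᵐ θ ∂ρ₀, (∑ i, |θ.1 i|) + |θ.2| ≤ 1)
    (a b : Lp ℝ 2 ρ₀) {x : Fin d → ℝ} (hx : ∀ i, |x i| ≤ 1) :
    potential ρ₀ (a + b) x = potential ρ₀ a x + potential ρ₀ b x := by
  unfold potential
  rw [← integral_add (integrable_mul_feature hρ₀ a hx) (integrable_mul_feature hρ₀ b hx)]
  refine integral_congr_ae ?_
  filter_upwards [Lp.coeFn_add a b] with θ hθ
  rw [hθ, Pi.add_apply, add_mul]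

theorem potential_smul (c : ℝ) (a : Lp ℝ 2 ρ₀) (x : Fin d → ℝ) :
    potential ρ₀ (c • a) x = c * potential ρ₀ a x := by
  unfold potential
  rw [← integral_const_mul]
  refine integral_congr_ae ?_
  filter_upwards [Lp.coeFn_smul c a] with θ hθ
  rw [hθ, Pi.smul_apply, smul_eq_mul, mul_assoc]

theorem potential_sub [IsProbabilityMeasure ρ₀]
    (hρ₀ : ∀ᵐ θ ∂ρ₀, (∑ i, |θ.1 i|) + |θ.2| ≤ 1)
    (a b : Lp ℝ 2 ρ₀) {x : Fin d → ℝ} (hx : ∀ i, |x i| ≤ 1) :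
    potential ρ₀ (a - b) x = potential ρ₀ a x - potential ρ₀ b x := by
  have h := potential_add hρ₀ (a - b) b hx
  rw [sub_add_cancel] at h
  linarith

theorem integrable_potential [IsProbabilityMeasure ρ₀]
    (hρ₀ : ∀ᵐ θ ∂ρ₀, (∑ i, |θ.1 i|) + |θ.2| ≤ 1)
    {Q : Measure (Fin d → ℝ)} [IsFiniteMeasure Q]
    (hQ : ∀ᵐ x ∂Q, ∀ i, |x i| ≤ 1) (a : Lp ℝ 2 ρ₀) : Integrable (potential ρ₀ a) Q := by
  refine Integrable.of_bound (measurable_potential a).aestronglyMeasurable (∫ θ, |a θ| ∂ρ₀) ?_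
  filter_upwards [hQ] with x hx
  exact abs_potential_le hρ₀ a hx

theorem integral_potential [IsProbabilityMeasure ρ₀]
    (hρ₀ : ∀ᵐ θ ∂ρ₀, (∑ i, |θ.1 i|) + |θ.2| ≤ 1)
    {Q : Measure (Fin d → ℝ)} [IsProbabilityMeasure Q]
    (hQ : ∀ᵐ x ∂Q, ∀ i, |x i| ≤ 1) (a : Lp ℝ 2 ρ₀) :
    Integrable (fun θ => a θ * ∫ x, relu (θ.1 ⬝ᵥ x + θ.2) ∂Q) ρ₀ ∧
    ∫ x, potential ρ₀ a x ∂Q = ∫ θ, a θ * ∫ x, relu (θ.1 ⬝ᵥ x + θ.2) ∂Q ∂ρ₀ := by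
  have hint : Integrable (Function.uncurry fun (x : Fin d → ℝ) (θ : (Fin d → ℝ) × ℝ) =>
      a θ * relu (θ.1 ⬝ᵥ x + θ.2)) (Q.prod ρ₀) := by
    refine (((Lp.memLp a).integrable one_le_two).comp_snd Q).mono
      (stronglyMeasurable_uncurry_mul_feature a).aestronglyMeasurable ?_
    filter_upwards [Measure.quasiMeasurePreserving_fst.ae hQ,
      Measure.quasiMeasurePreserving_snd.ae hρ₀] with p hx hθ
    exact abs_mul_feature_le hθ hx _
  have h1 := hint.integral_prod_right
  have h2 := integral_integral_swap hint
  simp only [Function.uncurry, integral_const_mul] at h1 h2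
  exact ⟨h1, h2⟩

/-- By Fubini, the sampling error of a whole potential is a pairing of its parameters with the
errors of single features. -/
theorem mean_potential_sub_integral [IsProbabilityMeasure ρ₀]
    (hρ₀ : ∀ᵐ θ ∂ρ₀, (∑ i, |θ.1 i|) + |θ.2| ≤ 1)
    {Q : Measure (Fin d → ℝ)} [IsProbabilityMeasure Q]
    (hQ : ∀ᵐ x ∂Q, ∀ i, |x i| ≤ 1) (a : Lp ℝ 2 ρ₀) {n : ℕ} {x : Fin n → Fin d → ℝ}
    (hx : ∀ i j, |x i j| ≤ 1) :
    (∑ i, potential ρ₀ a (x i)) / n - ∫ y, potential ρ₀ a y ∂Q =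
      ∫ θ, a θ * ((∑ i, relu (θ.1 ⬝ᵥ x i + θ.2)) / n - ∫ y, relu (θ.1 ⬝ᵥ y + θ.2) ∂Q) ∂ρ₀ := by
  obtain ⟨h1, h2⟩ := integral_potential hρ₀ hQ a
  have h3 : Integrable (fun θ => (∑ i, a θ * relu (θ.1 ⬝ᵥ x i + θ.2)) / n) ρ₀ :=
    (integrable_finsetSum _ fun i _ => integrable_mul_feature hρ₀ a (hx i)).div_const _
  rw [h2]
  unfold potential
  rw [← integral_finsetSum _ fun i _ => integrable_mul_feature hρ₀ a (hx i),
    ← integral_div, ← integral_sub h3 h1]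
  congr 1
  ext θ
  rw [mul_sub, ← Finset.mul_sum, mul_div_assoc]

theorem objective_empirical (P : Measure (Fin d → ℝ)) {n : ℕ} (x : Fin n → Fin d → ℝ)
    (V : (Fin d → ℝ) → ℝ) :
    objective P (empirical x) V =
      (∑ i, V (x i)) / n + Real.log (∫ y, Real.exp (-V y) ∂P) := by
  unfold objective empirical
  rw [integral_smul_measure, integral_finsetSum_measure fun i _ => integrable_dirac (by simp)]
  simp only [integral_dirac, ENNReal.toReal_inv, ENNReal.toReal_natCast, smul_eq_mul]
  rw [inv_mul_eq_div]

theorem klDiv_generated_potential [IsProbabilityMeasure ρ₀]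
    (hρ₀ : ∀ᵐ θ ∂ρ₀, (∑ i, |θ.1 i|) + |θ.2| ≤ 1)
    {P : Measure (Fin d → ℝ)} [IsProbabilityMeasure P]
    (hP : ∀ᵐ x ∂P, ∀ i, |x i| ≤ 1) (a b : Lp ℝ 2 ρ₀) :
    0 ≤ ∫ x, potential ρ₀ (b - a) x ∂(generated P (potential ρ₀ a))
        + Real.log (∫ x, Real.exp (-potential ρ₀ b x) ∂P)
        - Real.log (∫ x, Real.exp (-potential ρ₀ a x) ∂P) ∧
    InformationTheory.klDiv (generated P (potential ρ₀ a)) (generated P (potential ρ₀ b)) =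
      ENNReal.ofReal (∫ x, potential ρ₀ (b - a) x ∂(generated P (potential ρ₀ a))
        + Real.log (∫ x, Real.exp (-potential ρ₀ b x) ∂P)
        - Real.log (∫ x, Real.exp (-potential ρ₀ a x) ∂P)) := by
  have hbd : ∀ c : Lp ℝ 2 ρ₀, ∀ᵐ x ∂P, |potential ρ₀ c x| ≤ ∫ θ, |c θ| ∂ρ₀ := fun c =>
    hP.mono fun x hx => abs_potential_le hρ₀ c hx
  have hQ : ∀ᵐ x ∂(generated P (potential ρ₀ a)), ∀ i, |x i| ≤ 1 :=
    (tilted_absolutelyContinuous _ _).ae_le hP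
  have h := klDiv_tilted_neg (measurable_potential a).aemeasurable
    (measurable_potential b).aemeasurable (hbd a) (hbd b)
  have hsub : ∫ x, potential ρ₀ (b - a) x ∂(generated P (potential ρ₀ a)) =
      ∫ x, potential ρ₀ b x ∂(generated P (potential ρ₀ a)) -
        ∫ x, potential ρ₀ a x ∂(generated P (potential ρ₀ a)) := by
    have : IsFiniteMeasure (generated P (potential ρ₀ a)) := by
      unfold generated; infer_instance
    rw [← integral_sub (integrable_potential hρ₀ hQ b) (integrable_potential hρ₀ hQ a)]
    refine integral_congr_ae ?_
    filter_upwards [hQ] with x hx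
    exact potential_sub hρ₀ b a hx
  rw [hsub]
  exact h

/-- Convexity comes from Gibbs' variational principle: with the linear form `h ↦ (sample mean of
V_h) - 𝔼_Q[V_h]`, `Q` generated by `V_b`, the gap in the inequality is a relative entropy. Neither
differentiating the log-partition function nor continuity of the form is needed. -/
theorem exists_subgradient_objective [IsProbabilityMeasure ρ₀]
    (hρ₀ : ∀ᵐ θ ∂ρ₀, (∑ i, |θ.1 i|) + |θ.2| ≤ 1)
    {P : Measure (Fin d → ℝ)} [IsProbabilityMeasure P]
    (hP : ∀ᵐ x ∂P, ∀ i, |x i| ≤ 1) {n : ℕ} {x : Fin n → Fin d → ℝ}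
    (hx : ∀ i j, |x i j| ≤ 1) (b : Lp ℝ 2 ρ₀) :
    ∃ l : Lp ℝ 2 ρ₀ →ₗ[ℝ] ℝ, ∀ y, objective P (empirical x) (potential ρ₀ b) + l (y - b) ≤
      objective P (empirical x) (potential ρ₀ y) := by
  set Q := generated P (potential ρ₀ b) with hQdef
  have hQ : ∀ᵐ x ∂Q, ∀ i, |x i| ≤ 1 := (tilted_absolutelyContinuous _ _).ae_le hP
  have : IsFiniteMeasure Q := by rw [hQdef]; unfold generated; infer_instance
  refine ⟨{ toFun := fun h => (∑ i, potential ρ₀ h (x i)) / n - ∫ y, potential ρ₀ h y ∂Q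
            map_add' := fun g h => ?_
            map_smul' := fun c h => ?_ }, fun y => ?_⟩
  · have h1 : ∫ y, potential ρ₀ (g + h) y ∂Q =
        ∫ y, potential ρ₀ g y ∂Q + ∫ y, potential ρ₀ h y ∂Q := by
      rw [← integral_add (integrable_potential hρ₀ hQ g) (integrable_potential hρ₀ hQ h)]
      refine integral_congr_ae ?_
      filter_upwards [hQ] with x hx
      exact potential_add hρ₀ g h hx
    rw [h1, Finset.sum_congr rfl fun i _ => potential_add hρ₀ g h (hx i),
      Finset.sum_add_distrib]
    ring
  · simp only [potential_smul, integral_const_mul, ← Finset.mul_sum, smul_eq_mul,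
      RingHom.id_apply]
    ring
  · have h := (klDiv_generated_potential hρ₀ hP b y).1
    rw [objective_empirical, objective_empirical]
    simp only [LinearMap.coe_mk, AddHom.coe_mk]
    rw [Finset.sum_congr rfl fun i _ => potential_sub hρ₀ y b (hx i), Finset.sum_sub_distrib,
      sub_div]
    linarith

/-! ### Deterministic error bound along the flow -/

/-- The error of the trained distribution is controlled by the initial distance to a
representative of the target potential and by the averaged deviation of the sample. -/
theorem klDiv_gradientFlow_le [IsProbabilityMeasure ρ₀]
    (hρ₀ : ∀ᵐ θ ∂ρ₀, (∑ i, |θ.1 i|) + |θ.2| ≤ 1)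
    {P : Measure (Fin d → ℝ)} [IsProbabilityMeasure P]
    (hP : ∀ᵐ x ∂P, ∀ i, |x i| ≤ 1) {n : ℕ} (hn : 1 ≤ n) {x : Fin n → Fin d → ℝ}
    (hx : ∀ i j, |x i j| ≤ 1) {a₀ : Lp ℝ 2 ρ₀} {a : ℝ → Lp ℝ 2 ρ₀}
    (ha : IsGradientFlow
      (fun b : Lp ℝ 2 ρ₀ => objective P (empirical x) (potential ρ₀ b)) a₀ a)
    (y : Lp ℝ 2 ρ₀) {t : ℝ} (ht : 0 < t) :
    InformationTheory.klDiv (generated P (potential ρ₀ y)) (generated P (potential ρ₀ (a t))) ≤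
      ENNReal.ofReal (‖a₀ - y‖ ^ 2 / (2 * t) + t / 2 *
        ∫ θ, |(∑ i, relu (θ.1 ⬝ᵥ x i + θ.2)) / n -
          ∫ z, relu (θ.1 ⬝ᵥ z + θ.2) ∂(generated P (potential ρ₀ y))| ∂ρ₀) := by
  rw [(klDiv_generated_potential hρ₀ hP y (a t)).2]
  refine ENNReal.ofReal_le_ofReal ?_
  set Q := generated P (potential ρ₀ y) with hQdef
  have hQ : ∀ᵐ x ∂Q, ∀ i, |x i| ≤ 1 := (tilted_absolutelyContinuous _ _).ae_le hP
  have : IsProbabilityMeasure Q := isProbabilityMeasure_tilted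
    (integrable_exp_of_bound (C := ∫ θ, |y θ| ∂ρ₀) (measurable_potential y).neg.aemeasurable
      (hP.mono fun x hx => by rw [abs_neg]; exact abs_potential_le hρ₀ y hx))
  set h := a t - y with hh
  set e : (Fin d → ℝ) × ℝ → ℝ := fun θ =>
    (∑ i, relu (θ.1 ⬝ᵥ x i + θ.2)) / n - ∫ z, relu (θ.1 ⬝ᵥ z + θ.2) ∂Q with he
  have hme : Measurable e :=
    measurable_mean_feature_sub Q x
  have he1 : ∀ᵐ θ ∂ρ₀, |e θ| ≤ 1 := by
    filter_upwards [hρ₀] with θ hθ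
    exact abs_mean_sub_le (measurable_feature.comp (measurable_prodMk_left (x := θ))) hQ
      (fun x hx => feature_mem_Icc hθ hx) hn hx
  have hflow := ha.mul_sub_add_le y
    (fun b g hg => by
      obtain ⟨l, hl⟩ := exists_subgradient_objective hρ₀ hP hx b
      exact add_inner_le_of_hasGradientAt hg l hl y) ht.le
  rw [objective_empirical, objective_empirical] at hflow
  have hdev := mean_potential_sub_integral hρ₀ hQ h hx
  rw [hh, Finset.sum_congr rfl fun i _ => potential_sub hρ₀ (a t) y (hx i),
    Finset.sum_sub_distrib, sub_div, ← hh] at hdev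
  have hyoung := neg_integral_mul_le h hme.aestronglyMeasurable he1 ht
  set A := (∑ i, potential ρ₀ (a t) (x i)) / n with hA
  set B := (∑ i, potential ρ₀ y (x i)) / n with hB
  have hdecay : A + Real.log (∫ z, Real.exp (-potential ρ₀ (a t) z) ∂P) -
      (B + Real.log (∫ z, Real.exp (-potential ρ₀ y z) ∂P)) ≤
        ‖a₀ - y‖ ^ 2 / (2 * t) - ‖h‖ ^ 2 / (2 * t) := by
    rw [← sub_div, le_div_iff₀ (by positivity)]
    linarith
  -- Sum of `hdecay` and `hyoung`, linked by `hdev`; `‖h‖² / (2t)` cancels.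
  linarith

end BiasPotential

/-! ### High-probability bound and infimum over representatives -/

theorem mainTheorem1 (d n : ℕ) (hd : 1 ≤ d) (hn : 1 ≤ n)
    (P : Measure (Fin d → ℝ)) [IsProbabilityMeasure P]
    (hP : ∀ᵐ x ∂P, ∀ i, |x i| ≤ 1)
    (ρ₀ : Measure ((Fin d → ℝ) × ℝ)) [IsProbabilityMeasure ρ₀]
    (hρ₀ : ∀ᵐ θ ∂ρ₀, (∑ i, |θ.1 i|) + |θ.2| ≤ 1)
    (Vstar : (Fin d → ℝ) → ℝ) (hVstar : BiasPotential.rkhsNorm ρ₀ P Vstar < ∞)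
    (Qstar : Measure (Fin d → ℝ)) (hQstar : Qstar = BiasPotential.generated P Vstar)
    (a₀ : Lp ℝ 2 ρ₀)
    (δ : ℝ) (hδ₀ : 0 < δ) (hδ₁ : δ < 1) :
    ∃ E : Set (Fin n → Fin d → ℝ), MeasurableSet E ∧
      ENNReal.ofReal (1 - δ) ≤ Measure.pi (fun _ : Fin n => Qstar) E ∧
      ∀ x ∈ E, ∀ a : ℝ → Lp ℝ 2 ρ₀,
        BiasPotential.IsGradientFlow
          (fun b : Lp ℝ 2 ρ₀ => BiasPotential.objective P (BiasPotential.empirical x)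
            (BiasPotential.potential ρ₀ b)) a₀ a →
        ∀ t : ℝ, 0 < t →
          InformationTheory.klDiv Qstar
              (BiasPotential.generated P (BiasPotential.potential ρ₀ (a t))) ≤
            BiasPotential.rkhsNorm ρ₀ P (Vstar - BiasPotential.potential ρ₀ a₀) ^ 2
                / ENNReal.ofReal (2 * t) +
              ENNReal.ofReal (2 * (4 * (√(2 * Real.log (2 * (d : ℝ))) / √(n : ℝ)) +
                √(2 * Real.log (2 / δ)) / √(n : ℝ)) * t) := by
  have hn0 : (0 : ℝ) < n := by positivity
  obtain ⟨y₀, hy₀⟩ : ∃ y : Lp ℝ 2 ρ₀, Vstar =ᵐ[P] BiasPotential.potential ρ₀ y := by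
    by_contra hne
    push Not at hne
    simp [BiasPotential.rkhsNorm, hne] at hVstar
  have hgen : ∀ y : Lp ℝ 2 ρ₀, Vstar =ᵐ[P] BiasPotential.potential ρ₀ y →
      Qstar = BiasPotential.generated P (BiasPotential.potential ρ₀ y) := fun y hy =>
    hQstar.trans (tilted_congr (hy.mono fun x hx => by simp [hx]))
  have hQprob : IsProbabilityMeasure Qstar := by
    rw [hgen y₀ hy₀]
    exact isProbabilityMeasure_tilted (BiasPotential.integrable_exp_of_bound
      (C := ∫ θ, |y₀ θ| ∂ρ₀) (BiasPotential.measurable_potential y₀).neg.aemeasurable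
      (hP.mono fun x hx => by rw [abs_neg]; exact BiasPotential.abs_potential_le hρ₀ y₀ hx))
  have hQ : ∀ᵐ x ∂Qstar, ∀ i, |x i| ≤ 1 := by
    rw [hQstar]
    exact (tilted_absolutelyContinuous _ _).ae_le hP
  have hlog : 0 < Real.log (2 / δ) := Real.log_pos (by rw [lt_div_iff₀ hδ₀]; linarith)
  -- Solves `2 exp (-2ns²) = δ`.
  set s : ℝ := √(Real.log (2 / δ) / (2 * n)) with hs
  set T : (Fin n → Fin d → ℝ) → ℝ := fun x => ∫ θ, |(∑ i, BiasPotential.relu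
    (θ.1 ⬝ᵥ x i + θ.2)) / n - ∫ z, BiasPotential.relu (θ.1 ⬝ᵥ z + θ.2) ∂Qstar| ∂ρ₀ with hT
  have hTm : Measurable T := ((BiasPotential.measurable_mean_sub Qstar
    BiasPotential.measurable_feature n).abs.stronglyMeasurable.integral_prod_right').measurable
  have hEm : MeasurableSet {x | T x < s} := hTm measurableSet_Iio
  have hcube : MeasurableSet {x : Fin n → Fin d → ℝ | ∀ i j, |x i j| ≤ 1} := by
    simp only [Set.ofPred_forall]
    exact MeasurableSet.iInter fun i => MeasurableSet.iInter fun j =>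
      measurableSet_le (by fun_prop) measurable_const
  -- The deterministic bound needs every sample point in the cube; this costs only a null set.
  refine ⟨{x | T x < s} ∩ {x | ∀ i j, |x i j| ≤ 1}, hEm.inter hcube, ?_, ?_⟩
  · have hae := BiasPotential.ae_pi_forall_mem (K := {x : Fin d → ℝ | ∀ j, |x j| ≤ 1}) hQ n
    rw [measure_inter_conull (by exact hae)]
    have hconc := BiasPotential.measure_le_integral_abs_mean_sub Qstar ρ₀
      BiasPotential.measurable_feature (K := {x : Fin d → ℝ | ∀ j, |x j| ≤ 1}) hQ
      (hρ₀.mono fun θ hθ x hx => BiasPotential.feature_mem_Icc hθ hx) hn (Real.sqrt_nonneg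
        (Real.log (2 / δ) / (2 * n)))
    have hδ : 2 * Real.exp (-2 * n * s ^ 2) = δ := by
      rw [hs, Real.sq_sqrt (by positivity),
        show -2 * (n : ℝ) * (Real.log (2 / δ) / (2 * n)) = -Real.log (2 / δ) by field_simp,
        Real.exp_neg, Real.exp_log (by positivity)]
      field_simp
    rw [← hs, hδ] at hconc
    have hcompl : {x | T x < s} = {x | s ≤ T x}ᶜ := by ext; simp
    rw [hcompl, prob_compl_eq_one_sub (measurableSet_le measurable_const hTm),
      ENNReal.ofReal_sub _ hδ₀.le, ENNReal.ofReal_one]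
    exact tsub_le_tsub_left hconc _
  · rintro x ⟨hxT, hxK⟩ a ha t ht
    set C : ℝ := 2 * (4 * (√(2 * Real.log (2 * (d : ℝ))) / √(n : ℝ)) +
                √(2 * Real.log (2 / δ)) / √(n : ℝ)) * t with hC
    -- Here `s` is half of `√(2 log (2/δ)) / √n`, and the nonnegative `log 2d` term is merely added.
    have hsC : t / 2 * T x ≤ C := by
      have h1 : s ≤ √(2 * Real.log (2 / δ)) / √(n : ℝ) := by
        rw [hs, ← Real.sqrt_div' _ hn0.le]
        refine Real.sqrt_le_sqrt ?_
        rw [div_le_div_iff₀ (by positivity) hn0]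
        nlinarith [mul_pos hlog hn0]
      have h2 : 0 ≤ √(2 * Real.log (2 * (d : ℝ))) / √(n : ℝ) := by positivity
      have h3 : T x ≤ √(2 * Real.log (2 / δ)) / √(n : ℝ) := (le_of_lt hxT).trans h1
      have h4 : 0 ≤ s := Real.sqrt_nonneg _
      rw [hC]
      nlinarith
    have hC0 : 0 ≤ C := by positivity
    have hbound : ∀ b : Lp ℝ 2 ρ₀,
        Vstar - BiasPotential.potential ρ₀ a₀ =ᵐ[P] BiasPotential.potential ρ₀ b →
        InformationTheory.klDiv Qstar
            (BiasPotential.generated P (BiasPotential.potential ρ₀ (a t))) ≤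
          ‖b‖ₑ ^ 2 / ENNReal.ofReal (2 * t) + ENNReal.ofReal C := by
      intro b hb
      have hrep : Vstar =ᵐ[P] BiasPotential.potential ρ₀ (a₀ + b) := by
        filter_upwards [hb, hP] with z hz hzK
        rw [BiasPotential.potential_add hρ₀ a₀ b hzK, ← hz, Pi.sub_apply]
        ring
      have h := BiasPotential.klDiv_gradientFlow_le hρ₀ hP hn hxK ha (a₀ + b) ht
      rw [← hgen _ hrep, sub_add_cancel_left, norm_neg] at h
      refine h.trans ?_
      rw [← ofReal_norm, ← ENNReal.ofReal_pow (norm_nonneg _),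
        ← ENNReal.ofReal_div_of_pos (by positivity),
        ← ENNReal.ofReal_add (by positivity) hC0]
      exact ENNReal.ofReal_le_ofReal (by gcongr)
    -- A monotone continuous map fixing `⊤` commutes with infima, including the empty inner one for
    -- a `b` that represents nothing relevant.
    set G : ℝ≥0∞ → ℝ≥0∞ := fun r => r ^ 2 / ENNReal.ofReal (2 * t) + ENNReal.ofReal C with hG
    have hmono : Monotone G := fun r r' h => by simp only [hG]; gcongr
    have hcont : Continuous G := ((ENNReal.continuous_div_const _ (by simpa using ht)).comp
      (ENNReal.continuous_pow 2)).add continuous_const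
    have htop : G ⊤ = ⊤ := by
      simp only [hG, ENNReal.top_pow two_ne_zero, ENNReal.top_div_of_ne_top ENNReal.ofReal_ne_top,
        top_add]
    change _ ≤ G (BiasPotential.rkhsNorm ρ₀ P _)
    unfold BiasPotential.rkhsNorm
    rw [hmono.map_iInf_of_continuousAt hcont.continuousAt htop]
    refine le_iInf fun b => ?_
    simp only [Function.comp_apply]
    rw [hmono.map_iInf_of_continuousAt hcont.continuousAt htop]
    exact le_iInf fun hb => hbound b hb
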